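/- Theorem. Let an unknown matrix $M \in \mathbb{F}_2^{n\times n}$ be accessible only through queries which, given $u, v \in \mathbb{F}_2^n$, return $u^{\mathrm T} M v \in \mathbb{F}_2$. A randomized query algorithm is a probability distribution over deterministic algorithms, each of which chooses its queries adaptively (every query may depend on the answers to the previous ones) and finally outputs "yes" or "no". A permutation matrix is a matrix with entries in $\{0,1\}$ in which each row and each column contains exactly one entry equal to $1$. Then $\Omega(n)$ queries are necessary to determine with constant probability whether $M$ is a permutation matrix: for every constant $p > 1/2$ there is a constant $c = c(p) > 0$ such that, for every $n$, every randomized query algorithm that makes at most $q$ queries (on every input and for every outcome of its random choices) and that, on every $M \in \mathbb{F}_2^{n\times n}$, correctly decides with probability at least $p$ whether $M$ is a permutation matrix, satisfies $q \ge c\,n$. -/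

import Mathlib

open scoped Matrix

/-- A deterministic adaptive algorithm with vector-matrix-vector queries to an unknown `n × n`
matrix over `F` and a yes/no output: either it stops with an answer, or it chooses vectors `u`, `v`
and continues in a way that depends on the value of the query. -/
inductive QueryAlg (F : Type) (n : ℕ) : Type
  | output (b : Bool) : QueryAlg F n
  | query (u v : Fin n → F) (next : F → QueryAlg F n) : QueryAlg F n

namespace QueryAlg

variable {F : Type} [Field F] {n : ℕ}

/-- The answer of the algorithm when the unknown matrix is `M`; the query `(u, v)` returns
`uᵀ M v`. -/
def run (M : Matrix (Fin n) (Fin n) F) : QueryAlg F n → Bool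
  | output b => b
  | query u v next => (next (u ⬝ᵥ (M *ᵥ v))).run M

/-- The number of queries that the algorithm makes when the unknown matrix is `M`. -/
def queryCount (M : Matrix (Fin n) (Fin n) F) : QueryAlg F n → ℕ
  | output _ => 0
  | query u v next => (next (u ⬝ᵥ (M *ᵥ v))).queryCount M + 1

end QueryAlg

/-- `M` has entries in `{0, 1}`, and each row and each column contains exactly one entry equal
to `1`. -/
def IsPermutationMatrix {F : Type} [Field F] {n : ℕ} (M : Matrix (Fin n) (Fin n) F) : Prop :=
  (∀ i j, M i j = 0 ∨ M i j = 1) ∧ (∀ i, ∃! j, M i j = 1) ∧ (∀ j, ∃! i, M i j = 1)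

/-- A randomized adaptive algorithm is a probability distribution over deterministic ones. (Over a
finite field there are only countably many of these, so a `PMF` is fully general.) -/
abbrev RandQueryAlg (F : Type) (n : ℕ) : Type := PMF (QueryAlg F n)

namespace RandQueryAlg

variable {F : Type} [Field F] {n : ℕ}

/-- On every input matrix and for every outcome of the random choices, at most `q` queries are
made. -/
def MakesAtMost (A : RandQueryAlg F n) (q : ℕ) : Prop :=
  ∀ T ∈ A.support, ∀ M : Matrix (Fin n) (Fin n) F, T.queryCount M ≤ q

/-- On every input matrix, the algorithm answers correctly with probability at least `p` whether
the matrix is a permutation matrix. -/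
def DecidesPermutation (A : RandQueryAlg F n) (p : ℝ) : Prop :=
  ∀ M : Matrix (Fin n) (Fin n) F,
    ENNReal.ofReal p ≤ A.toOuterMeasure {T | T.run M = true ↔ IsPermutationMatrix M}

end RandQueryAlg

/-! Deciding permutation matrices contains set disjointness. In the identity plus circulant `3 × 3`
blocks, the parameters `(0, 0)`, `(1, 0)`, `(0, 1)` give the three cyclic permutations and `(1, 1)`
the all-ones block. Queries are linear forms, so `q` of them leave a blind space of codimension at
most `q`, which fixes at most `q` bits `t i` (`card_determined_le`). If block `i` is `(0, 0)` and
neither of its two directions is determined, the sum of two blind changes makes it `(1, 1)` while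
every other block stays on its side `s j` (`exists_hides`). These shifts inject accepted permutation
matrices into accepted non-permutations (`card_hides_le`). Averaging over `i`, `s`, `t` gives `(2p -
1) m ≤ 4q` with `m = n / 3`. -/

namespace QueryAlg

/-! ### Changes of the input that the queries cannot see -/

section Blind

variable {F : Type} [Field F] {n : ℕ}

/-- The query `(u, v)` as a linear form in the matrix. -/
def queryForm (u v : Fin n → F) : Matrix (Fin n) (Fin n) F →ₗ[F] F where
  toFun M := u ⬝ᵥ (M *ᵥ v)
  map_add' M N := by rw [Matrix.add_mulVec, dotProduct_add]
  map_smul' a M := by rw [Matrix.smul_mulVec, dotProduct_smul, RingHom.id_apply]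

/-- The directions in which none of the queries made on input `M` can see a change. -/
def blindSpace (M : Matrix (Fin n) (Fin n) F) :
    QueryAlg F n → Submodule F (Matrix (Fin n) (Fin n) F)
  | output _ => ⊤
  | query u v next =>
      LinearMap.ker (queryForm u v) ⊓ (next (u ⬝ᵥ (M *ᵥ v))).blindSpace M

theorem query_add_of_mem_ker {u v : Fin n → F} {M D : Matrix (Fin n) (Fin n) F}
    (hD : D ∈ LinearMap.ker (queryForm u v)) :
    u ⬝ᵥ ((M + D) *ᵥ v) = u ⬝ᵥ (M *ᵥ v) := by
  have h : u ⬝ᵥ (D *ᵥ v) = 0 := hD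
  rw [Matrix.add_mulVec, dotProduct_add, h, add_zero]

theorem run_add_of_mem_blindSpace {M D : Matrix (Fin n) (Fin n) F} (T : QueryAlg F n)
    (hD : D ∈ T.blindSpace M) : T.run (M + D) = T.run M := by
  induction T with
  | output b => rfl
  | query u v next ih =>
    simp only [blindSpace, Submodule.mem_inf] at hD
    simp only [run, query_add_of_mem_ker hD.1]
    exact ih _ hD.2

/-- A blind change leaves every answer, hence every later query, as it was. This makes blind shifts
reversible: the shifted input still reveals the space from which the shift was chosen. -/
theorem blindSpace_add_of_mem {M D : Matrix (Fin n) (Fin n) F} (T : QueryAlg F n)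
    (hD : D ∈ T.blindSpace M) : T.blindSpace (M + D) = T.blindSpace M := by
  induction T with
  | output b => rfl
  | query u v next ih =>
    simp only [blindSpace, Submodule.mem_inf] at hD
    simp only [blindSpace, query_add_of_mem_ker hD.1]
    rw [ih _ hD.2]

theorem finrank_le_finrank_inf_ker_add_one {V : Type*} [AddCommGroup V] [Module F V]
    [FiniteDimensional F V] (U : Submodule F V) (f : V →ₗ[F] F) :
    Module.finrank F U ≤ Module.finrank F (LinearMap.ker f ⊓ U : Submodule F V) + 1 := by
  have h1 := LinearMap.finrank_range_add_finrank_ker (f.domRestrict U)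
  have h2 : Module.finrank F (LinearMap.range (f.domRestrict U)) ≤ 1 := by
    simpa using Submodule.finrank_le (LinearMap.range (f.domRestrict U))
  have h3 : Module.finrank F (LinearMap.ker (f.domRestrict U)) =
      Module.finrank F (LinearMap.ker f ⊓ U : Submodule F V) := by
    rw [← Submodule.finrank_map_subtype_eq U (LinearMap.ker (f.domRestrict U)),
      LinearMap.domRestrict, LinearMap.ker_comp, Submodule.map_comap_subtype, inf_comm]
  omega

theorem finrank_le_finrank_comap_blindSpace {V : Type*} [AddCommGroup V] [Module F V]
    [FiniteDimensional F V] (φ : V →ₗ[F] Matrix (Fin n) (Fin n) F)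
    (M : Matrix (Fin n) (Fin n) F) (T : QueryAlg F n) :
    Module.finrank F V ≤ Module.finrank F ((T.blindSpace M).comap φ) + T.queryCount M := by
  induction T with
  | output b =>
    rw [blindSpace, Submodule.comap_top, finrank_top]
    exact Nat.le_add_right _ _
  | query u v next ih =>
    have h := ih (u ⬝ᵥ (M *ᵥ v))
    have h' := finrank_le_finrank_inf_ker_add_one
      (((next (u ⬝ᵥ (M *ᵥ v))).blindSpace M).comap φ) (queryForm u v ∘ₗ φ)
    refine (h.trans (Nat.add_le_add_right h' _)).trans (le_of_eq ?_)
    rw [blindSpace, Submodule.comap_inf, ← LinearMap.ker_comp]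
    exact Nat.add_right_comm _ _ _

/-- A subspace of `ι → F` vanishes on at most as many coordinates as its codimension. -/
theorem card_vanishing_add_finrank_le {ι : Type*} [Fintype ι] (U : Submodule F (ι → F))
    (S : Finset ι) (hS : ∀ i ∈ S, ∀ d ∈ U, d i = 0) :
    S.card + Module.finrank F U ≤ Fintype.card ι := by
  classical
  let f : (ι → F) →ₗ[F] (S → F) := LinearMap.funLeft F F (fun i : S => (i : ι))
  have hf : Function.Surjective f :=
    LinearMap.funLeft_surjective_of_injective F F _ Subtype.val_injective
  have h1 := LinearMap.finrank_range_add_finrank_ker f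
  rw [LinearMap.range_eq_top.mpr hf, finrank_top, Module.finrank_fintype_fun_eq_card,
    Module.finrank_fintype_fun_eq_card, Fintype.card_coe] at h1
  have h2 : U ≤ LinearMap.ker f := by
    intro d hd
    rw [LinearMap.mem_ker]
    funext i
    exact hS i i.2 d hd
  have h3 := Submodule.finrank_mono h2
  omega

end Blind

/-! ### Disjointness against adaptive linear queries -/

section Counting

variable {m n : ℕ}

/-- The pairs of vectors whose `j`-th entry is `(t j, 0)` or `(0, t j)`, as selected by `s j`. -/
def spread (s : Fin m → ZMod 2) : (Fin m → ZMod 2) →ₗ[ZMod 2] (Fin m → ZMod 2 × ZMod 2) where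
  toFun t j := ((1 - s j) * t j, s j * t j)
  map_add' t t' := by funext j; simp [mul_add]
  map_smul' a t := by funext j; simp [mul_left_comm]

theorem spread_apply (s t : Fin m → ZMod 2) (j : Fin m) :
    spread s t j = ((1 - s j) * t j, s j * t j) := rfl

/-- A zero block does not show its side, so both choices of `s i` give one input with one blind
space. -/
theorem spread_update_zero (s t : Fin m → ZMod 2) (i : Fin m) (a : ZMod 2) :
    spread (Function.update s i a) (Function.update t i 0) = spread s (Function.update t i 0) := by
  funext j
  rcases eq_or_ne j i with rfl | h <;> simp [spread_apply, *]

theorem sum_sum_update {ι : Type*} [Fintype ι] [DecidableEq ι] (i : ι)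
    (f : (ι → ZMod 2) → ℕ) :
    ∑ s, ∑ a, f (Function.update s i a) = 2 * ∑ s, f s := by
  have h : ∀ s : ι → ZMod 2, ∑ a, f (Function.update s i a) = ∑ a, f (s + Pi.single i a) := by
    intro s
    rw [← Equiv.sum_comp (Equiv.addLeft (s i))]
    refine Finset.sum_congr rfl fun a _ => congrArg f ?_
    funext j
    rcases eq_or_ne j i with rfl | hj <;> simp [*]
  simp_rw [h]
  rw [Finset.sum_comm]
  have h' : ∀ a : ZMod 2, ∑ s : ι → ZMod 2, f (s + Pi.single i a) = ∑ s, f s :=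
    fun a =>
    Equiv.sum_comp (Equiv.addRight (Pi.single i a : ι → ZMod 2)) f
  simp [h']

variable (M₀ : Matrix (Fin n) (Fin n) (ZMod 2))
  (G : (Fin m → ZMod 2 × ZMod 2) →ₗ[ZMod 2] Matrix (Fin n) (Fin n) (ZMod 2))

/-- On the input given by `s` and `t`, the answers determine the `i`-th entry of `t`. -/
def Determined (T : QueryAlg (ZMod 2) n) (s t : Fin m → ZMod 2) (i : Fin m) : Prop :=
  ∀ d, G (spread s d) ∈ T.blindSpace (M₀ + G (spread s t)) → d i = 0

/-- The inputs in which no block is `(1, 1)` and block `i` is `(0, 0)`. -/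
def disjointInput (i : Fin m) (s t : Fin m → ZMod 2) : Matrix (Fin n) (Fin n) (ZMod 2) :=
  M₀ + G (spread s (Function.update t i 0))

/-- The inputs in which block `i` is `(1, 1)`. -/
def crossingInput (i : Fin m) (s t : Fin m → ZMod 2) : Matrix (Fin n) (Fin n) (ZMod 2) :=
  M₀ + G (spread s (Function.update t i 0) + Pi.single i (1, 1))

open Classical in
theorem card_determined_le (T : QueryAlg (ZMod 2) n) {q : ℕ} (hq : ∀ M, T.queryCount M ≤ q)
    (s t : Fin m → ZMod 2) :
    (Finset.univ.filter (Determined M₀ G T s t)).card ≤ q := by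
  have h1 := finrank_le_finrank_comap_blindSpace (G ∘ₗ spread s) (M₀ + G (spread s t)) T
  have h2 := card_vanishing_add_finrank_le
    ((T.blindSpace (M₀ + G (spread s t))).comap (G ∘ₗ spread s))
    (Finset.univ.filter (Determined M₀ G T s t)) (fun i hi d hd =>
      (Finset.mem_filter.mp hi).2 d hd)
  have h3 := hq (M₀ + G (spread s t))
  rw [Module.finrank_fintype_fun_eq_card] at h1
  omega

/-- Adding `d` elsewhere and `(1, 1)` in block `i` is a change invisible in `K`. -/
def Hides (K : Submodule (ZMod 2) (Matrix (Fin n) (Fin n) (ZMod 2))) (i : Fin m)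
    (s d : Fin m → ZMod 2) : Prop :=
  d i = 0 ∧ G (spread s d + Pi.single i (1, 1)) ∈ K

theorem exists_hides (T : QueryAlg (ZMod 2) n) (i : Fin m) (s t : Fin m → ZMod 2)
    (h0 : ¬ Determined M₀ G T (Function.update s i 0) (Function.update t i 0) i)
    (h1 : ¬ Determined M₀ G T (Function.update s i 1) (Function.update t i 0) i) :
    ∃ d, Hides G (T.blindSpace (disjointInput M₀ G i s t)) i s d := by
  unfold Determined at h0 h1
  rw [spread_update_zero] at h0 h1
  push Not at h0 h1
  obtain ⟨d, hd, hdi⟩ := h0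
  obtain ⟨e, he, hei⟩ := h1
  have two : ∀ a : ZMod 2, a ≠ 0 → a = 1 := by decide
  refine ⟨Function.update (d + e) i 0, by simp, ?_⟩
  have : spread s (Function.update (d + e) i 0) + Pi.single i (1, 1) =
      spread (Function.update s i 0) d + spread (Function.update s i 1) e := by
    funext j
    rcases eq_or_ne j i with rfl | h
    · simp [spread_apply, two _ hdi, two _ hei]
    · simp [spread_apply, h, mul_add]
  rw [this, map_add]
  exact Submodule.add_mem _ hd he

open Classical in
theorem card_hides_le (T : QueryAlg (ZMod 2) n) (i : Fin m) (s : Fin m → ZMod 2) :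
    (Finset.univ.filter fun t => T.run (disjointInput M₀ G i s t) = true ∧
      ∃ d, Hides G (T.blindSpace (disjointInput M₀ G i s t)) i s d).card ≤
    (Finset.univ.filter fun t => T.run (crossingInput M₀ G i s t) = true).card := by
  -- The shift must depend on the blind space alone, not on `t`: equal images then have equal blind
  -- spaces, so equal shifts, and the map is injective.
  let δ : Submodule (ZMod 2) (Matrix (Fin n) (Fin n) (ZMod 2)) → Fin m → ZMod 2 :=
    fun K => if h : ∃ d, Hides G K i s d then h.choose else 0
  have hδ : ∀ K, (∃ d, Hides G K i s d) → Hides G K i s (δ K) := by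
    intro K h
    simp only [δ, dif_pos h]
    exact h.choose_spec
  have key : ∀ t, (∃ d, Hides G (T.blindSpace (disjointInput M₀ G i s t)) i s d) →
      crossingInput M₀ G i s (t + δ (T.blindSpace (disjointInput M₀ G i s t))) =
      disjointInput M₀ G i s t +
        G (spread s (δ (T.blindSpace (disjointInput M₀ G i s t))) + Pi.single i (1, 1)) := by
    intro t h
    have h0 := (hδ _ h).1
    generalize δ (T.blindSpace (disjointInput M₀ G i s t)) = d at h0
    have : Function.update (t + d) i 0 = Function.update t i 0 + d := by
      funext j
      rcases eq_or_ne j i with rfl | hj <;> simp [*]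
    simp only [crossingInput, disjointInput, this, map_add, add_assoc]
  refine Finset.card_le_card_of_injOn
    (fun t => t + δ (T.blindSpace (disjointInput M₀ G i s t))) ?_ ?_
  · intro t ht
    simp only [Finset.coe_filter, Finset.mem_univ, true_and, Set.mem_ofPred_eq] at ht ⊢
    rw [key t ht.2, run_add_of_mem_blindSpace T (hδ _ ht.2).2]
    exact ht.1
  · intro t ht t' ht' htt
    simp only [Finset.coe_filter, Finset.mem_univ, true_and, Set.mem_ofPred_eq] at ht ht' htt
    have e1 := congrArg T.blindSpace (key t ht.2)
    have e2 := congrArg T.blindSpace (key t' ht'.2)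
    rw [blindSpace_add_of_mem T (hδ _ ht.2).2] at e1
    rw [blindSpace_add_of_mem T (hδ _ ht'.2).2, ← htt, e1] at e2
    rw [e2] at htt
    exact add_right_cancel htt

-- The sum over `a` covers each `s` twice, and fixing `t i = 0` costs another factor 2 against a
-- uniform `t`.
open Classical in
theorem sum_determined_le (T : QueryAlg (ZMod 2) n) (i : Fin m) :
    ∑ s, ∑ t, ∑ a : ZMod 2, (if Determined M₀ G T (Function.update s i a)
      (Function.update t i 0) i then 1 else 0) ≤
    4 * ∑ s, ∑ t, if Determined M₀ G T s t i then 1 else 0 := by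
  have h := sum_sum_update i
    (fun s => ∑ t, if Determined M₀ G T s t i then 1 else 0)
  calc _ = ∑ s, ∑ a : ZMod 2, ∑ t, (if Determined M₀ G T (Function.update s i a)
            (Function.update t i 0) i then 1 else 0) :=
        Finset.sum_congr rfl fun s _ => Finset.sum_comm
    _ ≤ ∑ s, ∑ a : ZMod 2, 2 * ∑ t, (if Determined M₀ G T (Function.update s i a) t i
          then 1 else 0) := by
        refine Finset.sum_le_sum fun s _ => Finset.sum_le_sum fun a _ => ?_
        rw [← sum_sum_update i]
        refine Finset.sum_le_sum fun t _ => ?_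
        exact Finset.single_le_sum (f := fun b : ZMod 2 =>
          if Determined M₀ G T (Function.update s i a) (Function.update t i b) i then 1 else 0)
          (fun _ _ => Nat.zero_le _) (Finset.mem_univ 0)
    _ = 4 * ∑ s, ∑ t, if Determined M₀ G T s t i then 1 else 0 := by
        simp_rw [← Finset.mul_sum]
        rw [h]
        ring

open Classical in
theorem sum_run_disjointInput_le (T : QueryAlg (ZMod 2) n) (i : Fin m) :
    ∑ s, ∑ t, (if T.run (disjointInput M₀ G i s t) = true then 1 else 0) ≤
    ∑ s, ∑ t, (if T.run (crossingInput M₀ G i s t) = true then 1 else 0) +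
    4 * ∑ s, ∑ t, if Determined M₀ G T s t i then 1 else 0 := by
  refine le_trans ?_ (Nat.add_le_add_left (sum_determined_le M₀ G T i) _)
  rw [← Finset.sum_add_distrib]
  refine Finset.sum_le_sum fun s _ => ?_
  have h := card_hides_le M₀ G T i s
  simp only [Finset.card_filter] at h
  refine le_trans ?_ (Nat.add_le_add_right h _)
  rw [← Finset.sum_add_distrib]
  refine Finset.sum_le_sum fun t _ => ?_
  have h2 := exists_hides M₀ G T i s t
  have hsum : ∀ g : ZMod 2 → ℕ, ∑ a, g a = g 0 + g 1 := fun g => Fin.sum_univ_two g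
  rw [hsum]
  by_cases hr : T.run (disjointInput M₀ G i s t) = true
  · by_cases h0 : Determined M₀ G T (Function.update s i 0) (Function.update t i 0) i
    · simp [h0]
      split_ifs <;> omega
    · by_cases h1 : Determined M₀ G T (Function.update s i 1) (Function.update t i 0) i
      · simp [h1]
        split_ifs <;> omega
      · simp [hr, h2 h0 h1]
  · simp [hr]

theorem card_run_disjointInput_le (T : QueryAlg (ZMod 2) n) {q : ℕ}
    (hq : ∀ M, T.queryCount M ≤ q) :
    ∑ i : Fin m, ∑ s, ∑ t, (if T.run (disjointInput M₀ G i s t) = true then 1 else 0) ≤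
    ∑ i : Fin m, ∑ s, ∑ t, (if T.run (crossingInput M₀ G i s t) = true then 1 else 0) +
      4 * (q * (2 ^ m * 2 ^ m)) := by
  classical
  refine (Finset.sum_le_sum fun i _ => sum_run_disjointInput_le M₀ G T i).trans ?_
  rw [Finset.sum_add_distrib, ← Finset.mul_sum]
  refine Nat.add_le_add_left (Nat.mul_le_mul_left 4 ?_) _
  rw [Finset.sum_comm]
  have : ∀ s : Fin m → ZMod 2, ∑ i : Fin m, ∑ t, (if Determined M₀ G T s t i then 1 else 0) ≤
      2 ^ m * q := by
    intro s
    rw [Finset.sum_comm]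
    refine (Finset.sum_le_card_nsmul _ _ q fun t _ => ?_).trans (by simp)
    rw [← Finset.card_filter]
    exact card_determined_le M₀ G T hq s t
  refine (Finset.sum_le_card_nsmul _ _ _ fun s _ => this s).trans (le_of_eq ?_)
  simp
  ring

end Counting

end QueryAlg

/-! ### Averaging over the random choices -/

/-- If every algorithm in the support of `A` is right on few of the inputs in a family of
permutation matrices and equally many other matrices, then so is `A`. -/
theorem RandQueryAlg.DecidesPermutation.le_of_forall_support {F : Type} [Field F] {n : ℕ}
    {A : RandQueryAlg F n} {p : ℝ} (hp : 0 ≤ p) (hA : A.DecidesPermutation p)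
    {ι : Type*} [Fintype ι] (Y N : ι → Matrix (Fin n) (Fin n) F)
    (hY : ∀ k, IsPermutationMatrix (Y k)) (hN : ∀ k, ¬ IsPermutationMatrix (N k)) (B : ℕ)
    (hB : ∀ T ∈ A.support, ∑ k, (if T.run (Y k) = true then 1 else 0) ≤
      ∑ k, (if T.run (N k) = true then 1 else 0) + B) :
    (2 * p - 1) * Fintype.card ι ≤ B := by
  classical
  have hB' : ∀ T ∈ A.support, ∑ k, ((if T.run (Y k) = true then (1 : ENNReal) else 0) +
      (if T.run (N k) = true then 0 else 1)) ≤ (Fintype.card ι + B : ℕ) := by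
    intro T hT
    have h1 : ∑ k, ((if T.run (Y k) = true then 1 else 0) +
        (if T.run (N k) = true then 0 else 1)) ≤ Fintype.card ι + B := by
      have h2 : ∑ k, ((if T.run (N k) = true then 1 else 0) +
          (if T.run (N k) = true then 0 else 1)) = Fintype.card ι := by
        rw [Finset.sum_congr rfl (g := fun _ => 1) (fun k _ => by split_ifs <;> rfl)]
        simp
      have h3 := hB T hT
      rw [Finset.sum_add_distrib] at h2 ⊢
      omega
    exact_mod_cast (Nat.cast_le (α := ENNReal)).mpr h1
  have h : ∑ _k : ι, (ENNReal.ofReal p + ENNReal.ofReal p) ≤ (Fintype.card ι + B : ℕ) := by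
    calc _ ≤ ∑ k, (A.toOuterMeasure {T | T.run (Y k) = true ↔ IsPermutationMatrix (Y k)} +
          A.toOuterMeasure {T | T.run (N k) = true ↔ IsPermutationMatrix (N k)}) :=
          Finset.sum_le_sum fun k _ => add_le_add (hA _) (hA _)
      _ = ∑ k, ∑' T, A T * ((if T.run (Y k) = true then 1 else 0) +
          (if T.run (N k) = true then 0 else 1)) := by
          refine Finset.sum_congr rfl fun k _ => ?_
          rw [PMF.toOuterMeasure_apply, PMF.toOuterMeasure_apply, ← ENNReal.tsum_add]
          refine tsum_congr fun T => ?_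
          simp only [Set.indicator_apply, Set.mem_ofPred_eq, hY k, hN k, iff_true, iff_false]
          rw [mul_add]
          congr 1 <;> split_ifs <;> simp_all
      _ = ∑' T, A T * ∑ k, ((if T.run (Y k) = true then 1 else 0) +
          (if T.run (N k) = true then 0 else 1)) := by
          rw [← Summable.tsum_finsetSum fun _ _ => ENNReal.summable]
          simp_rw [Finset.mul_sum]
      _ ≤ ∑' T, A T * (Fintype.card ι + B : ℕ) := by
          refine ENNReal.tsum_le_tsum fun T => ?_
          by_cases hT : T ∈ A.support
          · exact mul_le_mul_right (hB' T hT) _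
          · rw [(PMF.apply_eq_zero_iff A T).mpr hT, zero_mul, zero_mul]
      _ = (Fintype.card ι + B : ℕ) := by rw [ENNReal.tsum_mul_right, A.tsum_coe, one_mul]
  rw [← ENNReal.ofReal_add hp hp, Finset.sum_const, Finset.card_univ, nsmul_eq_mul,
    ← ENNReal.ofReal_natCast, ← ENNReal.ofReal_natCast, ← ENNReal.ofReal_mul (by positivity),
    ENNReal.ofReal_le_ofReal_iff (by positivity)] at h
  push_cast at h
  linarith

/-! ### Permutation matrices from circulant blocks -/

section Blocks

variable {m r n : ℕ}

/-- The first row of the circulant `3 × 3` block with parameter `z`, minus that of the identity. -/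
def blockRow (z : ZMod 2 × ZMod 2) : Fin 3 → ZMod 2 := ![z.1 + z.2, z.1, z.2]

/-- The block diagonal matrix with circulant blocks, in a given numbering of the rows. -/
def blockMatrix (e : (Fin m × Fin 3) ⊕ Fin r ≃ Fin n) :
    (Fin m → ZMod 2 × ZMod 2) →ₗ[ZMod 2] Matrix (Fin n) (Fin n) (ZMod 2) where
  toFun z := Matrix.of fun i j => match e.symm i, e.symm j with
    | Sum.inl (k, a), Sum.inl (l, b) => if k = l then blockRow (z k) (b - a) else 0
    | _, _ => 0
  map_add' z w := by
    ext i j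
    simp only [Matrix.of_apply, Matrix.add_apply]
    rcases e.symm i with ⟨k, a⟩ | k <;> rcases e.symm j with ⟨l, b⟩ | l <;> simp
    split_ifs
    · generalize b - a = c
      fin_cases c <;> simp [blockRow]
      ring
    · simp
  map_smul' c z := by
    ext i j
    simp only [Matrix.of_apply, Matrix.smul_apply, RingHom.id_apply, smul_eq_mul]
    rcases e.symm i with ⟨k, a⟩ | k <;> rcases e.symm j with ⟨l, b⟩ | l <;> simp
    refine if_congr Iff.rfl ?_ rfl
    generalize b - a = c
    fin_cases c <;> simp [blockRow, mul_add]

theorem isPermutationMatrix_of_equiv {F : Type} [Field F] {M : Matrix (Fin n) (Fin n) F}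
    (σ : Fin n ≃ Fin n) (h : ∀ i j, M i j = if σ i = j then 1 else 0) :
    IsPermutationMatrix M := by
  refine ⟨fun i j => ?_, fun i => ⟨σ i, by simp [h], fun j hj => ?_⟩,
    fun j => ⟨σ.symm j, by simp [h], fun i hi => ?_⟩⟩
  · rw [h]; split_ifs <;> simp
  · simpa [h, eq_comm] using hj
  · rw [Equiv.eq_symm_apply]
    simpa [h] using hi

theorem isPermutationMatrix_one_add_blockMatrix (e : (Fin m × Fin 3) ⊕ Fin r ≃ Fin n)
    {z : Fin m → ZMod 2 × ZMod 2} (hz : ∀ k, (z k).1 * (z k).2 = 0) :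
    IsPermutationMatrix (1 + blockMatrix e z) := by
  have hrow : ∀ z : ZMod 2 × ZMod 2, z.1 * z.2 = 0 →
      ∃ c : Fin 3, ∀ d : Fin 3, (if d = 0 then 1 else 0) + blockRow z d =
        if c = d then (1 : ZMod 2) else 0 := by
    decide
  choose c hc using fun k => hrow (z k) (hz k)
  let τ : (Fin m × Fin 3) ≃ (Fin m × Fin 3) := Equiv.prodShear (Equiv.refl _)
    (fun k => Equiv.addRight (c k))
  refine isPermutationMatrix_of_equiv
    ((e.symm.trans (Equiv.sumCongr τ (Equiv.refl _))).trans e) fun i j => ?_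
  obtain ⟨i, rfl⟩ := e.surjective i
  obtain ⟨j, rfl⟩ := e.surjective j
  rw [Matrix.add_apply, Matrix.one_apply]
  rcases i with ⟨k, a⟩ | k <;> rcases j with ⟨l, b⟩ | l <;> simp [blockMatrix, τ]
  by_cases hkl : k = l
  · subst hkl
    have := hc k (b - a)
    simp only [sub_eq_zero] at this
    simp only [true_and, if_true]
    have hab : a = b ↔ b = a := eq_comm
    simp only [hab, this, eq_sub_iff_add_eq, add_comm]
  · simp [hkl]

theorem not_isPermutationMatrix_one_add_blockMatrix (e : (Fin m × Fin 3) ⊕ Fin r ≃ Fin n)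
    {z : Fin m → ZMod 2 × ZMod 2} {k : Fin m} (hz : z k = (1, 1)) :
    ¬ IsPermutationMatrix (1 + blockMatrix e z) := by
  rintro ⟨-, h, -⟩
  have h0 : (1 + blockMatrix e z) (e (Sum.inl (k, 0))) (e (Sum.inl (k, 0))) = 1 := by
    simp [blockMatrix, hz, blockRow]
    decide
  have h1 : (1 + blockMatrix e z) (e (Sum.inl (k, 0))) (e (Sum.inl (k, 1))) = 1 := by
    simp [blockMatrix, hz, blockRow]
  have := (h (e (Sum.inl (k, 0)))).unique h0 h1
  simp at this

end Blocks

/-! ### The lower bound -/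

open QueryAlg in
theorem RandQueryAlg.DecidesPermutation.mul_le_four_mul {n q : ℕ} {A : RandQueryAlg (ZMod 2) n}
    {p : ℝ} (hp : 0 ≤ p) (hq : A.MakesAtMost q) (hA : A.DecidesPermutation p)
    {m : ℕ} (hm : 3 * m ≤ n) : (2 * p - 1) * m ≤ 4 * q := by
  have e : (Fin m × Fin 3) ⊕ Fin (n - 3 * m) ≃ Fin n :=
    Fintype.equivOfCardEq (by simp; omega)
  have key := hA.le_of_forall_support hp (ι := Fin m × (Fin m → ZMod 2) × (Fin m → ZMod 2))
    (fun k => disjointInput 1 (blockMatrix e) k.1 k.2.1 k.2.2)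
    (fun k => crossingInput 1 (blockMatrix e) k.1 k.2.1 k.2.2) ?_ ?_ (4 * (q * (2 ^ m * 2 ^ m)))
    ?_
  · simp only [Fintype.card_prod, Fintype.card_fin, Fintype.card_fun, ZMod.card] at key
    push_cast at key
    have hpos : (0 : ℝ) < 2 ^ m * 2 ^ m := by positivity
    refine le_of_mul_le_mul_right ?_ hpos
    linarith
  · rintro ⟨i, s, t⟩
    refine isPermutationMatrix_one_add_blockMatrix e fun k => ?_
    have : ∀ a b : ZMod 2, (1 - a) * b * (a * b) = 0 := by decide
    exact this _ _
  · rintro ⟨i, s, t⟩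
    exact not_isPermutationMatrix_one_add_blockMatrix e (k := i) (by simp [spread_apply])
  · intro T hT
    simp only [Fintype.sum_prod_type]
    exact card_run_disjointInput_le 1 (blockMatrix e) T (hq T hT)

/-- Without a query, the matrices `1` and `0` get the same answer. This serves `n < 3`, where no
block fits. -/
theorem RandQueryAlg.DecidesPermutation.le_queries {n q : ℕ} {A : RandQueryAlg (ZMod 2) n}
    {p : ℝ} (hp : 0 ≤ p) (hq : A.MakesAtMost q) (hA : A.DecidesPermutation p) (hn : 0 < n) :
    2 * p - 1 ≤ q := by
  have key := hA.le_of_forall_support hp (ι := Unit) (fun _ => 1) (fun _ => 0) ?_ ?_ q ?_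
  · simpa using key
  · exact fun _ => isPermutationMatrix_of_equiv (Equiv.refl _) fun i j => Matrix.one_apply
  · rintro - ⟨-, h, -⟩
    obtain ⟨j, hj, -⟩ := h ⟨0, hn⟩
    simp at hj
  · intro T hT
    cases T with
    | output b => exact Nat.le_add_right _ _
    | query u v next =>
      have := hq _ hT 0
      simp only [QueryAlg.queryCount] at this
      simp only [Finset.univ_unique, Finset.sum_singleton]
      split_ifs <;> omega

theorem mainTheorem6 (p : ℝ) (hp : 1 / 2 < p) :
    ∃ c : ℝ, 0 < c ∧ ∀ (n q : ℕ) (A : RandQueryAlg (ZMod 2) n),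
      A.MakesAtMost q → A.DecidesPermutation p → c * (n : ℝ) ≤ (q : ℝ) := by
  have hp0 : 0 ≤ p := by linarith
  -- Here `20 = 4 * 5`: the 4 is the loss in the counting, and `n ≤ 5 * (n / 3)` for `n ≥ 3`, tight
  -- at `n = 5`.
  refine ⟨(2 * p - 1) / 20, by linarith, fun n q A hq hA => ?_⟩
  rcases lt_or_ge n 3 with hn | hn
  · rcases Nat.eq_zero_or_pos n with rfl | hn0
    · simp
    · have h := hA.le_queries hp0 hq hn0
      have hn' : (n : ℝ) ≤ 3 := by exact_mod_cast hn.le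
      nlinarith
  · have h := hA.mul_le_four_mul hp0 hq (m := n / 3) (by omega)
    have hn' : (n : ℝ) ≤ 5 * (n / 3 : ℕ) := by exact_mod_cast (by omega : n ≤ 5 * (n / 3))
    nlinarith
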